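/- Let $K$ be an algebraically closed field of characteristic zero, let $n\ge 1$ and $k\ge 0$ be integers, and let $\mathfrak{sl}(n)$ be the Lie algebra of traceless $n\times n$ matrices over $K$. For a basis $e_1,\dots,e_n$ of $K^n$ and compositions $(a_1,\dots,a_m)$ and $(b_1,\dots,b_l)$ of $n$, the seaweed subalgebra of type $\frac{a_1|\cdots|a_m}{b_1|\cdots|b_l}$ is the set of all $x\in\mathfrak{sl}(n)$ that preserve each of the subspaces $\operatorname{span}\{e_1,\dots,e_{a_1+\cdots+a_i}\}$ $(0\le i\le m)$ and $\operatorname{span}\{e_{b_1+\cdots+b_j+1},\dots,e_n\}$ $(0\le j\le l)$. A maximal parabolic subalgebra of $\mathfrak{sl}(n)$ is a seaweed subalgebra (in some basis) for which one of the two compositions has a single part and the other has exactly two parts; up to conjugation these are the seaweeds of type $\frac{a|b}{n}$ with $a,b\geq 1$, $a+b=n$. The index of a finite-dimensional Lie algebra $\mathfrak g$ is $\min_{f\in\mathfrak g^*}\dim\ker B_f$, where $B_f(x,y)=f([x,y])$. Let $C_{2,1}(n,k)$ be the number of conjugacy classes, under conjugation by $SL(n)$, of maximal parabolic subalgebras of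 $\mathfrak{sl}(n)$ of index $k$. If $n=(k+1)t$ for some integer $t\ge 2$, then $C_{2,1}(n,k)=\varphi(t)$, where $\varphi$ is Euler's totient function. Otherwise $C_{2,1}(n,k)=0$ (in particular, $C_{2,1}(k+1,k)=0$). -/

import Mathlib

attribute [local instance 100] LieRing.ofAssociativeRing

noncomputable section

/-- The Kirillov form `B_f(x, y) = f([x, y])` of a linear form `f` on a Lie algebra `L`. -/
def kirillovForm {K L : Type*} [Field K] [LieRing L] [LieAlgebra K L]
    (f : Module.Dual K L) : LinearMap.BilinForm K L :=
  LinearMap.mk₂ K (fun x y => f ⁅x, y⁆)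
    (fun x x' y => by simp [add_lie]) (fun c x y => by simp)
    (fun x y y' => by simp [lie_add]) (fun c x y => by simp)

/-- The index of a (finite-dimensional) Lie algebra `L`: the minimum over all linear forms `f` on
`L` of the dimension of the kernel of the Kirillov form `B_f`. -/
def lieIndex (K L : Type*) [Field K] [LieRing L] [LieAlgebra K L] : ℕ :=
  ⨅ f : Module.Dual K L, Module.finrank K (LinearMap.ker (kirillovForm f))

/-- The Lie algebra `sl(n)` of traceless `n × n` matrices. -/
abbrev slAlg (K : Type*) [Field K] (n : ℕ) : LieSubalgebra K (Matrix (Fin n) (Fin n) K) :=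
  LieAlgebra.SpecialLinear.sl (Fin n) K

/-- The subspace `V_i = span {e_1, …, e_{a_1 + ⋯ + a_i}}` of the flag of the composition `a` of `n`
in the basis `e` of `K^n`. The basis is indexed from `0`; `a.sizeUpTo i = a_1 + ⋯ + a_i`, which is
`n` as soon as `i` is at least the number of parts. -/
def flagV {K : Type*} [Field K] {n : ℕ} (e : Module.Basis (Fin n) K (Fin n → K))
    (a : Composition n) (i : ℕ) : Submodule K (Fin n → K) :=
  Submodule.span K {v | ∃ l : Fin n, (l : ℕ) < a.sizeUpTo i ∧ v = e l}

/-- The subspace `W_j = span {e_{b_1 + ⋯ + b_j + 1}, …, e_n}` of the opposite flag of the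
composition `b` of `n` in the basis `e` of `K^n`. -/
def flagW {K : Type*} [Field K] {n : ℕ} (e : Module.Basis (Fin n) K (Fin n → K))
    (b : Composition n) (j : ℕ) : Submodule K (Fin n → K) :=
  Submodule.span K {v | ∃ l : Fin n, b.sizeUpTo j ≤ (l : ℕ) ∧ v = e l}

/-- The seaweed subalgebra of `sl(n)` of type `a / b` in the basis `e` of `K^n`: the traceless
matrices that preserve both flags. -/
def seaweed {K : Type*} [Field K] {n : ℕ} (e : Module.Basis (Fin n) K (Fin n → K))
    (a b : Composition n) : LieSubalgebra K (slAlg K n) where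
  carrier := {x | (∀ i, ∀ v ∈ flagV e a i, x.1.mulVec v ∈ flagV e a i) ∧
    (∀ j, ∀ v ∈ flagW e b j, x.1.mulVec v ∈ flagW e b j)}
  zero_mem' := by
    constructor <;> intro i v _ <;> simp
  add_mem' := by
    rintro x y ⟨hx, hx'⟩ ⟨hy, hy'⟩
    constructor
    · intro i v hv
      simpa [Matrix.add_mulVec] using add_mem (hx i v hv) (hy i v hv)
    · intro i v hv
      simpa [Matrix.add_mulVec] using add_mem (hx' i v hv) (hy' i v hv)
  smul_mem' := by
    rintro c x ⟨hx, hx'⟩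
    constructor
    · intro i v hv
      simpa [Matrix.smul_mulVec] using Submodule.smul_mem _ c (hx i v hv)
    · intro i v hv
      simpa [Matrix.smul_mulVec] using Submodule.smul_mem _ c (hx' i v hv)
  lie_mem' := by
    rintro x y ⟨hx, hx'⟩ ⟨hy, hy'⟩
    constructor
    · intro i v hv
      simpa [Ring.lie_def, Matrix.sub_mulVec, Matrix.mulVec_mulVec] using
        sub_mem (hx i _ (hy i v hv)) (hy i _ (hx i v hv))
    · intro i v hv
      simpa [Ring.lie_def, Matrix.sub_mulVec, Matrix.mulVec_mulVec] using
        sub_mem (hx' i _ (hy' i v hv)) (hy' i _ (hx' i v hv))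

/-- A maximal parabolic subalgebra of `sl(n)`: a seaweed, in some basis of `K^n`, one of whose two
compositions is trivial (has a single part) and the other of which has exactly two parts. -/
def IsMaximalParabolic {K : Type*} [Field K] {n : ℕ} (p : LieSubalgebra K (slAlg K n)) : Prop :=
  ∃ (e : Module.Basis (Fin n) K (Fin n → K)) (a b : Composition n),
    ((a.length = 2 ∧ b.length = 1) ∨ (a.length = 1 ∧ b.length = 2)) ∧ p = seaweed e a b

/-- Two subalgebras `p`, `q` of `sl(n)` are conjugate if `q = g p g⁻¹` for some `g` in `SL(n)`. -/
def IsConjSubalgebra {K : Type*} [Field K] {n : ℕ} (p q : LieSubalgebra K (slAlg K n)) : Prop :=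
  ∃ g : Matrix.SpecialLinearGroup (Fin n) K,
    {x : Matrix (Fin n) (Fin n) K | ∃ y : slAlg K n, y ∈ q ∧ y.1 = x} =
      {x | ∃ y : slAlg K n, y ∈ p ∧ g.1 * y.1 * (g⁻¹).1 = x}

/-- Conjugation under `SL(n)` as an equivalence relation on the subalgebras of `sl(n)`. -/
def conjSetoid (K : Type*) [Field K] (n : ℕ) : Setoid (LieSubalgebra K (slAlg K n)) where
  r := IsConjSubalgebra
  iseqv := by
    have h1 (g : Matrix.SpecialLinearGroup (Fin n) K) : (g⁻¹).1 * g.1 = 1 := by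
      rw [← Matrix.SpecialLinearGroup.coe_mul, inv_mul_cancel, Matrix.SpecialLinearGroup.coe_one]
    refine ⟨fun p => ⟨1, ?_⟩, ?_, ?_⟩
    · ext x; simp
    · rintro p q ⟨g, h⟩
      refine ⟨g⁻¹, ?_⟩
      rw [Set.ext_iff] at h
      ext x
      constructor
      · rintro ⟨y, hy, rfl⟩
        obtain ⟨z, hz, hzy⟩ := (h _).2 ⟨y, hy, rfl⟩
        refine ⟨z, hz, ?_⟩
        rw [hzy, inv_inv]
        calc (g⁻¹).1 * (g.1 * y.1 * (g⁻¹).1) * g.1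
            = ((g⁻¹).1 * g.1) * y.1 * ((g⁻¹).1 * g.1) := by simp only [mul_assoc]
          _ = y.1 := by rw [h1]; simp
      · rintro ⟨y, hy, rfl⟩
        obtain ⟨z, hz, hzy⟩ := (h _).1 ⟨y, hy, rfl⟩
        refine ⟨z, hz, ?_⟩
        rw [← hzy, inv_inv]
        calc z.1 = ((g⁻¹).1 * g.1) * z.1 * ((g⁻¹).1 * g.1) := by rw [h1]; simp
          _ = (g⁻¹).1 * (g.1 * z.1 * (g⁻¹).1) * g.1 := by simp only [mul_assoc]
    · rintro p q r ⟨g, h⟩ ⟨g', h'⟩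
      refine ⟨g' * g, ?_⟩
      rw [h']
      rw [Set.ext_iff] at h
      ext x
      constructor
      · rintro ⟨y, hy, rfl⟩
        obtain ⟨z, hz, hzy⟩ := (h _).1 ⟨y, hy, rfl⟩
        refine ⟨z, hz, ?_⟩
        rw [← hzy, mul_inv_rev, Matrix.SpecialLinearGroup.coe_mul,
          Matrix.SpecialLinearGroup.coe_mul]
        simp only [mul_assoc]
      · rintro ⟨y, hy, rfl⟩
        obtain ⟨z, hz, hzy⟩ := (h _).2 ⟨y, hy, rfl⟩
        refine ⟨z, hz, ?_⟩
        rw [hzy, mul_inv_rev, Matrix.SpecialLinearGroup.coe_mul,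
          Matrix.SpecialLinearGroup.coe_mul]
        simp only [mul_assoc]

/-- `C_{2,1}(n, k)`: the number (in `ℕ∞`) of conjugacy classes of maximal parabolic subalgebras
of `sl(n)` of index `k`. -/
def numMaxParabolicClasses (K : Type*) [Field K] (n k : ℕ) : ℕ∞ :=
  Set.encard {c : Quotient (conjSetoid K n) | ∃ p : LieSubalgebra K (slAlg K n),
    IsMaximalParabolic p ∧ lieIndex K p = k ∧ Quotient.mk (conjSetoid K n) p = c}

end

/-!
A maximal parabolic subalgebra of `sl(n)` is the stabilizer of a subspace `U` with
`0 < dim U < n` (`IsMaximalParabolic.exists_isStabilizer`). Since `U` is the only proper nonzero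
subspace preserved by its stabilizer (`IsStabilizer.eq_of_forall_mulVec_mem`), and since `SL(n)` acts
transitively on subspaces of a given dimension, the conjugacy classes correspond to the dimensions
`d = 1, …, n - 1`. The index of the stabilizer is `gcd (d, n) - 1`
(`IsStabilizer.lieIndex_add_one`), so the classes of index `k` are counted by the `d` with
`gcd (d, n) = k + 1`: these are `φ (n / (k + 1))` in number if `k + 1` is a proper divisor of
`n`, and there are none otherwise.

For the index, let `n = a + b` with `a = d`. In a suitable basis the elements of the stabilizer
are the traceless block upper triangular matrices `x` with blocks `A`, `B`, `C`, and a linear form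
on them is `x ↦ tr (F x)`, where only three blocks `P`, `Q`, `R` of `F` matter. In characteristic
zero, dropping the trace condition adds exactly the scalar matrices to the kernel of the Kirillov
form, so that the kernel has dimension one less than the space `blockStab P Q R` of solutions of
`P A - A P = B Q`, `Q A = C Q`, `C R - R C = Q B` (`finrank_ker_kirillovForm_add_one`). The
minimum of `dim (blockStab P Q R)` is `gcd (a, b)`, by Euclid's algorithm: if `a ≤ b` and `Q` is
the inclusion of the first `a` coordinates, the equations reduce to equations of the same form for
the sizes `a` and `b - a`, with arbitrary new data (`finrank_blockStab_fromRows`). A general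
injective `Q` becomes this one after a change of basis, and a `Q` that is not injective is
perturbed to an injective one without increasing the dimension (`finite_setOf_finrank_ker_lt`).
The case `a ≥ b` follows by transposition. The algorithm ends with the centralizer of an `a × a`
matrix, whose minimal dimension is `a` (`hasMinFinrankBlockStab_zero`).
-/

open Module

/-! ### Linear algebra -/

/-- Semicontinuity of the kernel dimension in a pencil of linear maps. On a complement `C` of
`ker T` the map `T` has a left inverse `L`, and `T + s S` can fail to be injective on `C` only if
`-s⁻¹` is an eigenvalue of `L S`. -/
theorem finite_setOf_finrank_ker_lt {K V W : Type*} [Field K] [AddCommGroup V] [Module K V]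
    [FiniteDimensional K V] [AddCommGroup W] [Module K W] (T S : V →ₗ[K] W) :
    {s : K | finrank K (LinearMap.ker T) < finrank K (LinearMap.ker (T + s • S))}.Finite := by
  obtain ⟨C, hC⟩ := Submodule.exists_isCompl (LinearMap.ker T)
  have hinj : LinearMap.ker (T.domRestrict C) = ⊥ := by
    rw [LinearMap.ker_eq_bot']
    rintro ⟨v, hv⟩ h
    have := (Submodule.disjoint_def.1 hC.disjoint) v (by simpa using h) hv
    simpa using this
  obtain ⟨L, hL⟩ := LinearMap.exists_leftInverse_of_injective _ hinj
  have hfin : {μ : K | End.HasEigenvalue (L ∘ₗ S.domRestrict C) μ}.Finite :=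
    End.finite_hasEigenvalue _
  refine (hfin.preimage (f := fun s : K => -s⁻¹) ?_).subset ?_
  · exact (neg_injective.comp inv_injective).injOn
  · intro s hs
    have hdis : ¬ Disjoint (LinearMap.ker (T + s • S)) C := by
      intro hd
      have h1 := Submodule.finrank_add_finrank_le_of_disjoint hd
      have h2 := Submodule.finrank_add_eq_of_isCompl hC
      have : finrank K (LinearMap.ker T) < finrank K (LinearMap.ker (T + s • S)) := hs
      omega
    rw [Submodule.disjoint_def] at hdis
    push Not at hdis
    obtain ⟨v, hv, hvC, hv0⟩ := hdis
    have hLT : L (T v) = (⟨v, hvC⟩ : C) := LinearMap.congr_fun hL (⟨v, hvC⟩ : C)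
    have h1 : T v = -(s • S v) := by
      rw [LinearMap.mem_ker] at hv
      exact eq_neg_of_add_eq_zero_left (by simpa using hv)
    rw [h1, map_neg, map_smul] at hLT
    have hs0 : s ≠ 0 := by
      rintro rfl
      apply hv0
      simpa using congrArg Subtype.val hLT.symm
    refine End.hasEigenvalue_of_hasEigenvector (x := (⟨v, hvC⟩ : C)) ⟨?_, ?_⟩
    · rw [End.mem_eigenspace_iff]
      conv_rhs => rw [← hLT]
      simp [smul_smul, hs0]
    · intro h
      exact hv0 (congrArg Subtype.val h)

theorem Submodule.finrank_eq_of_injective_of_mem_iff {K V W : Type*} [Field K] [AddCommGroup V]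
    [Module K V] [AddCommGroup W] [Module K W] (φ : V → W) (hadd : ∀ x y, φ (x + y) = φ x + φ y)
    (hsmul : ∀ (c : K) x, φ (c • x) = c • φ x) (hφ : Function.Injective φ)
    (p : Submodule K V) (q : Submodule K W) (hp : ∀ x ∈ p, φ x ∈ q)
    (hq : ∀ y ∈ q, ∃ x ∈ p, φ x = y) : finrank K q = finrank K p := by
  let ψ : V →ₗ[K] W := { toFun := φ, map_add' := hadd, map_smul' := hsmul }
  have : q = p.map ψ := by
    ext y
    exact ⟨fun h => hq y h, by rintro ⟨x, hx, rfl⟩; exact hp x hx⟩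
  rw [this]
  exact ((Submodule.equivMapOfInjective ψ hφ p).finrank_eq).symm

/-! ### The kernel of the Kirillov form in block form -/

section blocks

variable {K : Type*} [Field K] {m n l : Type*} [Fintype m] [Fintype n] [Fintype l]

/-- Let `x` be the block matrix with blocks `A`, `B` above `0`, `C`, and let `F` be a block matrix
with `P`, `*` above `Q`, `R`. The map sends `(A, B, C)` to the blocks of `F x - x F` in the
positions `(1, 1)`, `(2, 1)` and `(2, 2)`, the last one up to sign; they do not depend on the
block `*`. -/
def blockStabMap (P : Matrix m m K) (Q : Matrix n m K) (R : Matrix n n K) :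
    Matrix m m K × Matrix m n K × Matrix n n K →ₗ[K]
      Matrix m m K × Matrix n m K × Matrix n n K where
  toFun x := (P * x.1 - x.1 * P - x.2.1 * Q, Q * x.1 - x.2.2 * Q,
    x.2.2 * R - R * x.2.2 - Q * x.2.1)
  map_add' x y := by
    simp only [Prod.fst_add, Prod.snd_add, Prod.mk_add_mk, mul_add, add_mul, Matrix.mul_add,
      Matrix.add_mul]
    refine Prod.ext ?_ (Prod.ext ?_ ?_) <;> dsimp only <;> abel
  map_smul' c x := by
    simp [smul_sub]

/-- The kernel of the Kirillov form of `x ↦ tr (F x)` on the algebra of all block upper triangular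
matrices (without a trace condition), where `F` has the blocks `P`, `*` above `Q`, `R`: the triples
`(A, B, C)` with `P A - A P = B Q`, `Q A = C Q` and `C R - R C = Q B`. -/
def blockStab (P : Matrix m m K) (Q : Matrix n m K) (R : Matrix n n K) :
    Submodule K (Matrix m m K × Matrix m n K × Matrix n n K) :=
  LinearMap.ker (blockStabMap P Q R)

theorem mem_blockStab {P : Matrix m m K} {Q : Matrix n m K} {R : Matrix n n K}
    {x : Matrix m m K × Matrix m n K × Matrix n n K} :
    x ∈ blockStab P Q R ↔ P * x.1 = x.1 * P + x.2.1 * Q ∧ Q * x.1 = x.2.2 * Q ∧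
      x.2.2 * R = R * x.2.2 + Q * x.2.1 := by
  simp [blockStab, blockStabMap, sub_sub, sub_eq_zero]

theorem blockStabMap_add_smul (P P' : Matrix m m K) (Q Q' : Matrix n m K) (R R' : Matrix n n K)
    (s : K) : blockStabMap (P + s • P') (Q + s • Q') (R + s • R') =
      blockStabMap P Q R + s • blockStabMap P' Q' R' := by
  refine LinearMap.ext fun x => ?_
  simp only [blockStabMap, LinearMap.coe_mk, AddHom.coe_mk, LinearMap.add_apply,
    LinearMap.smul_apply, Prod.smul_mk, Prod.mk_add_mk, add_mul, mul_add, Matrix.add_mul,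
    Matrix.mul_add, smul_sub, Matrix.smul_mul, Matrix.mul_smul]
  refine Prod.ext ?_ (Prod.ext ?_ ?_) <;> dsimp only <;> abel

/-- The equations of `blockStab` are symmetric under transposition, which exchanges the sizes of the
two diagonal blocks. -/
theorem finrank_blockStab_transpose (P : Matrix m m K) (Q : Matrix n m K) (R : Matrix n n K) :
    finrank K (blockStab R.transpose Q.transpose P.transpose) = finrank K (blockStab P Q R) := by
  refine Submodule.finrank_eq_of_injective_of_mem_iff
    (fun x : Matrix m m K × Matrix m n K × Matrix n n K =>
      (x.2.2.transpose, x.2.1.transpose, x.1.transpose))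
    (fun _ _ => rfl) (fun _ _ => rfl) ?_ _ _ ?_ ?_
  · rintro ⟨A, B, C⟩ ⟨A', B', C'⟩ h
    simp only [Prod.mk.injEq, Matrix.transpose_inj] at h
    obtain ⟨rfl, rfl, rfl⟩ := h
    rfl
  · rintro ⟨A, B, C⟩ h
    rw [mem_blockStab] at h ⊢
    obtain ⟨h1, h2, h3⟩ := h
    simp only [← Matrix.transpose_mul, ← Matrix.transpose_add, Matrix.transpose_inj]
    exact ⟨h3, h2.symm, h1⟩
  · rintro ⟨A, B, C⟩ h
    refine ⟨(C.transpose, B.transpose, A.transpose), ?_, rfl⟩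
    rw [mem_blockStab] at h ⊢
    obtain ⟨h1, h2, h3⟩ := h
    dsimp only at h1 h2 h3 ⊢
    rw [← Matrix.transpose_inj] at h1 h2 h3
    simp only [Matrix.transpose_mul, Matrix.transpose_add, Matrix.transpose_transpose] at h1 h2 h3
    exact ⟨h3, h2.symm, h1⟩

theorem Matrix.mul_mul_cancel_left_of_mul_eq_one {k : Type*} [DecidableEq m] {A : Matrix m n K}
    {B : Matrix n m K} (h : A * B = 1) (X : Matrix m k K) : A * (B * X) = X := by
  rw [← Matrix.mul_assoc, h, Matrix.one_mul]

/-- Invariance of `blockStab` under a change of basis `G` of the second block; the two index types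
of `G` may differ. -/
theorem finrank_blockStab_conj [DecidableEq n] [DecidableEq l] (P : Matrix m m K)
    (Q : Matrix n m K) (R : Matrix n n K)
    (G : Matrix l n K) (G' : Matrix n l K) (h : G * G' = 1) (h' : G' * G = 1) :
    finrank K (blockStab P (G * Q) (G * R * G')) = finrank K (blockStab P Q R) := by
  refine Submodule.finrank_eq_of_injective_of_mem_iff
    (fun x : Matrix m m K × Matrix m n K × Matrix n n K => (x.1, x.2.1 * G', G * x.2.2 * G'))
    (fun x y => by simp [Matrix.add_mul, Matrix.mul_add])
    (fun c x => by simp) ?_ _ _ ?_ ?_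
  · rintro ⟨A, B, C⟩ ⟨A', B', C'⟩ e
    simp only [Prod.mk.injEq] at e
    obtain ⟨rfl, e2, e3⟩ := e
    have e2 : B * G' * G = B' * G' * G := by rw [e2]
    have e3 : G' * (G * C * G') * G = G' * (G * C' * G') * G := by rw [e3]
    simp only [Matrix.mul_assoc, h', Matrix.mul_mul_cancel_left_of_mul_eq_one h',
      Matrix.mul_one] at e2 e3
    rw [e2, e3]
  · rintro ⟨A, B, C⟩ e
    rw [mem_blockStab] at e ⊢
    obtain ⟨h1, h2, h3⟩ := e
    dsimp only at h1 h2 h3 ⊢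
    simp only [Matrix.mul_assoc, Matrix.mul_mul_cancel_left_of_mul_eq_one h']
    refine ⟨h1, by rw [h2], ?_⟩
    rw [← Matrix.mul_assoc C, ← Matrix.mul_assoc R, ← Matrix.mul_assoc Q, ← Matrix.mul_add,
      ← Matrix.add_mul, h3]
  · rintro ⟨A, B, C⟩ e
    refine ⟨(A, B * G, G' * C * G), ?_, ?_⟩
    · rw [mem_blockStab] at e ⊢
      obtain ⟨h1, h2, h3⟩ := e
      dsimp only at h1 h2 h3 ⊢
      refine ⟨by rw [h1, Matrix.mul_assoc], ?_, ?_⟩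
      · simp only [Matrix.mul_assoc] at h2 ⊢
        rw [← h2, Matrix.mul_mul_cancel_left_of_mul_eq_one h']
      · have h3 : G' * (C * (G * R * G')) * G = G' * (G * R * G' * C + G * Q * B) * G := by
          rw [h3]
        simpa only [Matrix.mul_assoc, h', Matrix.mul_mul_cancel_left_of_mul_eq_one h',
          Matrix.mul_one, Matrix.mul_add, Matrix.add_mul] using h3
    · simp [Matrix.mul_assoc, h, Matrix.mul_mul_cancel_left_of_mul_eq_one h]

/-- For `Q` the inclusion of the first summand, the equation `Q A = C Q` says that `C` is block
upper triangular with first block `A`, two further equations determine `B`, and the remaining ones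
are those of `blockStab` for smaller matrices. -/
theorem mem_blockStab_fromRows_iff [DecidableEq m] {P R₁₁ A C₁₁ B₁ : Matrix m m K}
    {R₁₂ C₁₂ B₂ : Matrix m n K} {R₂₁ C₂₁ : Matrix n m K} {R₂₂ C₂₂ : Matrix n n K} :
    (A, Matrix.fromCols B₁ B₂, Matrix.fromBlocks C₁₁ C₁₂ C₂₁ C₂₂) ∈
      blockStab P (Matrix.fromRows (1 : Matrix m m K) (0 : Matrix n m K))
        (Matrix.fromBlocks R₁₁ R₁₂ R₂₁ R₂₂) ↔
      C₁₁ = A ∧ C₂₁ = 0 ∧ B₁ = P * A - A * P ∧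
        B₂ = A * R₁₂ + C₁₂ * R₂₂ - R₁₁ * C₁₂ - R₁₂ * C₂₂ ∧
        (A, C₁₂, C₂₂) ∈ blockStab (P + R₁₁) R₂₁ R₂₂ := by
  have e : Matrix.fromRows (1 : Matrix m m K) (0 : Matrix n m K) * Matrix.fromCols B₁ B₂ =
      Matrix.fromBlocks B₁ B₂ 0 0 := by
    rw [Matrix.fromRows_mul_fromCols]
    simp
  simp only [mem_blockStab, Matrix.fromCols_mul_fromRows, Matrix.fromRows_mul,
    Matrix.fromBlocks_mul_fromRows, Matrix.fromBlocks_multiply, Matrix.fromBlocks_add,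
    Matrix.fromBlocks_inj, Matrix.fromRows_ext_iff, e, Matrix.one_mul, Matrix.zero_mul,
    Matrix.mul_one, Matrix.mul_zero, add_zero]
  constructor
  · rintro ⟨h1, ⟨rfl, rfl⟩, h3, h4, h5, h6⟩
    simp only [Matrix.mul_zero, Matrix.zero_mul, add_zero, zero_add] at h3 h4 h5 h6
    refine ⟨rfl, rfl, ?_, ?_, ?_, h5.symm, ?_⟩
    · rw [h1]; abel
    · rw [h4]; abel
    · rw [Matrix.add_mul, Matrix.mul_add, h1, add_assoc, add_assoc, h3]; abel
    · rw [h6]; abel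
  · rintro ⟨rfl, rfl, rfl, rfl, h1, h2, h3⟩
    simp only [Matrix.mul_zero, Matrix.zero_mul, add_zero, zero_add]
    refine ⟨by abel, ⟨trivial, trivial⟩, ?_, by abel, h2.symm, ?_⟩
    · rw [Matrix.add_mul, Matrix.mul_add] at h1
      calc C₁₁ * R₁₁ + C₁₂ * R₂₁ = C₁₁ * P + C₁₁ * R₁₁ + C₁₂ * R₂₁ - C₁₁ * P := by abel
        _ = _ := by rw [← h1]; abel
    · rw [h3]; abel

/-- One step of the subtractive Euclidean algorithm: block sizes `(a, a + c)` reduce to `(a, c)`. -/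
theorem finrank_blockStab_fromRows [DecidableEq m] (P R₁₁ : Matrix m m K) (R₁₂ : Matrix m n K)
    (R₂₁ : Matrix n m K) (R₂₂ : Matrix n n K) :
    finrank K (blockStab P (Matrix.fromRows (1 : Matrix m m K) (0 : Matrix n m K))
      (Matrix.fromBlocks R₁₁ R₁₂ R₂₁ R₂₂)) = finrank K (blockStab (P + R₁₁) R₂₁ R₂₂) := by
  refine Submodule.finrank_eq_of_injective_of_mem_iff
    (fun x : Matrix m m K × Matrix m n K × Matrix n n K =>
      (x.1, Matrix.fromCols (P * x.1 - x.1 * P)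
        (x.1 * R₁₂ + x.2.1 * R₂₂ - R₁₁ * x.2.1 - R₁₂ * x.2.2),
        Matrix.fromBlocks x.1 x.2.1 0 x.2.2)) ?_ ?_ ?_ _ _ ?_ ?_
  · intro x y
    refine Prod.ext rfl (Prod.ext ?_ ?_)
    · ext i (j | j) <;> simp [Matrix.add_mul, Matrix.mul_add] <;> ring
    · simp [Matrix.fromBlocks_add]
  · intro c x
    refine Prod.ext rfl (Prod.ext ?_ ?_)
    · ext i (j | j) <;> simp [mul_sub, mul_add]
    · simp [Matrix.fromBlocks_smul]
  · rintro ⟨A, B, C⟩ ⟨A', B', C'⟩ e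
    simp only [Prod.mk.injEq, Matrix.fromBlocks_inj] at e
    obtain ⟨-, -, rfl, rfl, -, rfl⟩ := e
    rfl
  · rintro ⟨A, B, C⟩ e
    exact mem_blockStab_fromRows_iff.2 ⟨rfl, rfl, rfl, rfl, e⟩
  · rintro ⟨A, B, C⟩ e
    rw [← Matrix.fromCols_toCols B, ← Matrix.fromBlocks_toBlocks C] at e ⊢
    obtain ⟨h1, h2, h3, h4, h5⟩ := mem_blockStab_fromRows_iff.1 e
    exact ⟨_, h5, by dsimp only; rw [h1, h2, h3, h4]⟩

end blocks

/-! ### The Euclidean algorithm on block sizes -/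

/-- The columns of a matrix with independent columns extend to a basis: `Q` is the first block of
columns of an invertible matrix `G`. -/
theorem Matrix.exists_mul_fromRows_one_zero_eq {K : Type*} [Field K] {m l : Type*} [Fintype m]
    [DecidableEq m] [Fintype l] [DecidableEq l] {c : ℕ} (hc : Fintype.card l = Fintype.card m + c)
    (Q : Matrix l m K) (hQ : Function.Injective Q.mulVec) :
    ∃ (G : Matrix l (m ⊕ Fin c) K) (G' : Matrix (m ⊕ Fin c) l K), G * G' = 1 ∧ G' * G = 1 ∧
      G * Matrix.fromRows (1 : Matrix m m K) (0 : Matrix (Fin c) m K) = Q := by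
  have hli : LinearIndependent K Q.col := Matrix.mulVec_injective_iff.1 hQ
  let B₀ := Basis.sumExtend hli
  have : Finite (m ⊕ Basis.sumExtendIndex hli) := Module.Finite.finite_basis B₀
  have : Finite (Basis.sumExtendIndex hli) := Finite.sum_right m
  have : Fintype (Basis.sumExtendIndex hli) := Fintype.ofFinite _
  have hcard : Fintype.card (Basis.sumExtendIndex hli) = c := by
    have h := finrank_eq_card_basis B₀
    rw [finrank_fintype_fun_eq_card, Fintype.card_sum] at h
    omega
  let B : Basis (m ⊕ Fin c) K (l → K) :=
    B₀.reindex (Equiv.sumCongr (Equiv.refl m) (Fintype.equivFinOfCardEq hcard))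
  have hB (i : m) : B (Sum.inl i) = Q.col i := by
    simp only [B, B₀, Basis.sumExtend, Basis.reindex_apply, Basis.extend_apply_self]
    rfl
  refine ⟨(Pi.basisFun K l).toMatrix B, B.toMatrix (Pi.basisFun K l),
    Basis.toMatrix_mul_toMatrix_flip _ _, Basis.toMatrix_mul_toMatrix_flip _ _, ?_⟩
  rw [← Matrix.fromCols_toCols ((Pi.basisFun K l).toMatrix B), Matrix.fromCols_mul_fromRows]
  ext i j
  simp [Basis.toMatrix_apply, hB]

/-- `g` is the minimal dimension of `blockStab P Q R` for blocks of sizes `a` and `b`, that is, the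
index of the algebra of block upper triangular matrices in `gl(a + b)`. -/
def HasMinFinrankBlockStab (K : Type*) [Field K] (a b g : ℕ) : Prop :=
  (∀ (P : Matrix (Fin a) (Fin a) K) (Q : Matrix (Fin b) (Fin a) K) (R : Matrix (Fin b) (Fin b) K),
    g ≤ finrank K (blockStab P Q R)) ∧
  ∃ (P : Matrix (Fin a) (Fin a) K) (Q : Matrix (Fin b) (Fin a) K) (R : Matrix (Fin b) (Fin b) K),
    finrank K (blockStab P Q R) = g

theorem HasMinFinrankBlockStab.symm {K : Type*} [Field K] {a b g : ℕ}
    (h : HasMinFinrankBlockStab K a b g) : HasMinFinrankBlockStab K b a g := by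
  obtain ⟨h1, P, Q, R, h2⟩ := h
  refine ⟨fun P Q R => ?_, R.transpose, Q.transpose, P.transpose, ?_⟩
  · rw [← finrank_blockStab_transpose]
    exact h1 _ _ _
  · rw [finrank_blockStab_transpose, h2]

theorem finite_setOf_finrank_blockStab_lt {K : Type*} [Field K] {m n : Type*} [Fintype m]
    [Fintype n] (P P' : Matrix m m K) (Q Q' : Matrix n m K) (R R' : Matrix n n K) :
    {s : K | finrank K (blockStab P Q R) <
      finrank K (blockStab (P + s • P') (Q + s • Q') (R + s • R'))}.Finite := by
  refine (finite_setOf_finrank_ker_lt (blockStabMap P Q R) (blockStabMap P' Q' R')).subset ?_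
  intro s hs
  rw [Set.mem_ofPred_eq, blockStab, blockStab, blockStabMap_add_smul] at hs
  exact hs

theorem Matrix.finite_setOf_not_injective_mulVec_add_smul {K : Type*} [Field K] {m l : Type*}
    [Fintype m] [DecidableEq m] [Fintype l] (Q Q' : Matrix l m K) (L : Matrix m l K)
    (hL : L * Q' = 1) :
    {s : K | ¬ Function.Injective (Q + s • Q').mulVec}.Finite := by
  have hfin : {μ : K | End.HasEigenvalue (Matrix.toLin' (L * Q)) μ}.Finite :=
    End.finite_hasEigenvalue _
  refine (hfin.preimage (f := fun s : K => -s) neg_injective.injOn).subset ?_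
  intro s hs
  have hs : ¬ Function.Injective (Matrix.mulVecLin (Q + s • Q')) := hs
  rw [← LinearMap.ker_eq_bot, LinearMap.ker_eq_bot'] at hs
  push Not at hs
  obtain ⟨v, hv, hv0⟩ := hs
  refine End.hasEigenvalue_of_hasEigenvector (x := v) ⟨?_, hv0⟩
  rw [End.mem_eigenspace_iff, Matrix.toLin'_apply, ← Matrix.mulVec_mulVec]
  have h : Q.mulVec v = -(s • Q'.mulVec v) := by
    refine eq_neg_of_add_eq_zero_left ?_
    simpa [Matrix.add_mulVec, Matrix.smul_mulVec] using hv
  rw [h, Matrix.mulVec_neg, Matrix.mulVec_smul, Matrix.mulVec_mulVec, hL, Matrix.one_mulVec,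
    neg_smul]

/-- Euclid's step for the minimum. Where `Q` is injective the reduction applies directly. An
arbitrary `(P, Q, R)` is moved by a multiple of `(0, J, 0)`, `J` injective, to a place where
`Q + s J` is injective and the dimension has not grown. -/
theorem HasMinFinrankBlockStab.add_right {K : Type*} [Field K] [Infinite K] {a c g : ℕ}
    (h : HasMinFinrankBlockStab K a c g) : HasMinFinrankBlockStab K a (a + c) g := by
  obtain ⟨h1, P₁, Q₁, R₁, h2⟩ := h
  let e : Fin a ⊕ Fin c ≃ Fin (a + c) := finSumFinEquiv
  let G : Matrix (Fin (a + c)) (Fin a ⊕ Fin c) K := (1 : Matrix _ _ K).submatrix id e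
  let G' : Matrix (Fin a ⊕ Fin c) (Fin (a + c)) K := (1 : Matrix _ _ K).submatrix e id
  have hG : G * G' = 1 := by simp [G, G', Matrix.submatrix_mul_equiv]
  have hG' : G' * G = 1 := by
    simp only [G, G']
    rw [← Matrix.submatrix_mul _ _ e id e Function.bijective_id]
    simp
  let J : Matrix (Fin a ⊕ Fin c) (Fin a) K :=
    Matrix.fromRows (1 : Matrix _ _ K) (0 : Matrix (Fin c) (Fin a) K)
  have hJ : Matrix.fromCols (1 : Matrix (Fin a) (Fin a) K) (0 : Matrix (Fin a) (Fin c) K) * J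
      = 1 := by
    simp [J, Matrix.fromCols_mul_fromRows]
  let R₂ : Matrix (Fin a ⊕ Fin c) (Fin a ⊕ Fin c) K := Matrix.fromBlocks 0 0 Q₁ R₁
  refine ⟨fun P Q R => ?_, P₁, G * J, G * R₂ * G', ?_⟩
  · have hfin := (finite_setOf_finrank_blockStab_lt P 0 Q (G * J) R 0).union
      (Matrix.finite_setOf_not_injective_mulVec_add_smul Q (G * J)
        (Matrix.fromCols (1 : Matrix (Fin a) (Fin a) K) (0 : Matrix (Fin a) (Fin c) K) * G') (by
          rw [Matrix.mul_assoc, Matrix.mul_mul_cancel_left_of_mul_eq_one hG', hJ]))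
    obtain ⟨s, hs⟩ := hfin.infinite_compl.nonempty
    simp only [Set.mem_compl_iff, Set.mem_union, Set.mem_ofPred_eq, not_or, not_lt, not_not] at hs
    refine le_trans ?_ hs.1
    obtain ⟨H, H', hH, hH', hQ⟩ :=
      Matrix.exists_mul_fromRows_one_zero_eq (c := c) (by simp) _ hs.2
    have hR : R + s • 0 = H * (H' * R * H) * H' := by
      simp [Matrix.mul_assoc, hH, Matrix.mul_mul_cancel_left_of_mul_eq_one hH]
    rw [hR, ← hQ, finrank_blockStab_conj _ _ _ _ _ hH hH',
      ← Matrix.fromBlocks_toBlocks (H' * R * H), finrank_blockStab_fromRows]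
    exact h1 _ _ _
  · rw [finrank_blockStab_conj _ _ _ _ _ hG hG', finrank_blockStab_fromRows, add_zero, h2]

/-- For all but finitely many `t` the powers of `diag d + t P` below the size of the matrix are
independent: the matrix of the diagonals of these powers is polynomial in `t`, and at `t = 0` it is
the Vandermonde matrix of the distinct entries of `d`. -/
theorem Matrix.finite_setOf_not_linearIndependent_pow {K : Type*} [Field K] {a : ℕ}
    (d : Fin a → K) (hd : Function.Injective d) (P : Matrix (Fin a) (Fin a) K) :
    {t : K | ¬ LinearIndependent K (fun i : Fin a =>
      (Matrix.diagonal d + t • P : Matrix (Fin a) (Fin a) K) ^ (i : ℕ))}.Finite := by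
  let N : Matrix (Fin a) (Fin a) (Polynomial K) :=
    (Matrix.diagonal d).map Polynomial.C + (Polynomial.X : Polynomial K) • P.map Polynomial.C
  let M : Matrix (Fin a) (Fin a) (Polynomial K) := Matrix.of fun j i => (N ^ (i : ℕ)) j j
  have hN (t : K) : (Polynomial.evalRingHom t).mapMatrix N = Matrix.diagonal d + t • P := by
    ext i j
    by_cases h : i = j <;> simp [N, h] <;> ring
  have hM (t : K) : (Polynomial.evalRingHom t).mapMatrix M =
      Matrix.of fun j (i : Fin a) => ((Matrix.diagonal d + t • P) ^ (i : ℕ)) j j := by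
    ext j i
    simp only [RingHom.mapMatrix_apply, Matrix.map_apply, M, Matrix.of_apply]
    rw [← hN, ← map_pow]
    rfl
  have hdet : M.det ≠ 0 := by
    intro h
    have h0 : ((Polynomial.evalRingHom 0).mapMatrix M).det = 0 := by
      rw [← RingHom.map_det, h, map_zero]
    have hv : (Polynomial.evalRingHom 0).mapMatrix M = Matrix.vandermonde d := by
      rw [hM]
      ext j i
      simp [Matrix.diagonal_pow, Matrix.vandermonde_apply]
    rw [hv] at h0
    exact Matrix.det_vandermonde_ne_zero_iff.2 hd h0
  refine (Polynomial.finite_setOfPred_isRoot hdet).subset fun t ht => ?_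
  by_contra hne
  apply ht
  have hne : ((Polynomial.evalRingHom t).mapMatrix M).det ≠ 0 := by
    rw [← RingHom.map_det]
    exact hne
  have hcol := Matrix.linearIndependent_cols_of_det_ne_zero hne
  rw [hM] at hcol
  exact LinearIndependent.of_comp (Matrix.diagLinearMap (Fin a) K K) hcol

/-- With an empty second block, `blockStab` is the centralizer of `P`. Its minimal dimension is the
size `a`: the powers of a generic `P` are independent, and the centralizer of a diagonal matrix with
distinct entries consists of diagonal matrices. -/
theorem hasMinFinrankBlockStab_zero (K : Type*) [Field K] [CharZero K] (a : ℕ) :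
    HasMinFinrankBlockStab K a 0 a := by
  let d : Fin a → K := fun i => ((i : ℕ) : K)
  have hd : Function.Injective d := fun i j h => Fin.ext (Nat.cast_injective h)
  have lower (P : Matrix (Fin a) (Fin a) K) (Q : Matrix (Fin 0) (Fin a) K)
      (R : Matrix (Fin 0) (Fin 0) K) : a ≤ finrank K (blockStab P Q R) := by
    have hfin := ((finite_setOf_finrank_blockStab_lt P (Matrix.diagonal d) Q 0 R 0).union
      ((Matrix.finite_setOf_not_linearIndependent_pow d hd P).preimage
        (f := fun s : K => s⁻¹) inv_injective.injOn)).union (Set.finite_singleton 0)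
    obtain ⟨s, hs⟩ := hfin.infinite_compl.nonempty
    simp only [Set.mem_compl_iff, Set.mem_union, Set.mem_ofPred_eq, not_or, not_lt, not_not,
      Set.mem_preimage, Set.mem_singleton_iff] at hs
    obtain ⟨⟨hs1, hs2⟩, hs0⟩ := hs
    refine le_trans ?_ hs1
    -- The powers of `diag d + s⁻¹ P` commute with its multiple `P + s diag d`.
    have hP : P + s • Matrix.diagonal d = s • (Matrix.diagonal d + s⁻¹ • P) := by
      rw [smul_add, smul_smul, mul_inv_cancel₀ hs0, one_smul, add_comm]
    have hmem (i : Fin a) : ((Matrix.diagonal d + s⁻¹ • P) ^ (i : ℕ), 0, 0) ∈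
        blockStab (P + s • Matrix.diagonal d) (Q + s • 0) (R + s • 0) := by
      rw [mem_blockStab, hP]
      refine ⟨?_, Subsingleton.elim _ _, Subsingleton.elim _ _⟩
      rw [Matrix.zero_mul, add_zero, Matrix.smul_mul, Matrix.mul_smul, ← pow_succ, ← pow_succ']
    have hli : LinearIndependent K (fun i : Fin a =>
        (⟨_, hmem i⟩ : blockStab (P + s • Matrix.diagonal d) (Q + s • 0) (R + s • 0))) :=
      LinearIndependent.of_comp (LinearMap.fst K _ _ ∘ₗ Submodule.subtype _) hs2
    simpa using hli.fintype_card_le_finrank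
  refine ⟨lower, Matrix.diagonal d, 0, 0, le_antisymm ?_ (lower _ _ _)⟩
  let φ : blockStab (Matrix.diagonal d) (0 : Matrix (Fin 0) (Fin a) K) 0 →ₗ[K] Fin a → K :=
    Matrix.diagLinearMap (Fin a) K K ∘ₗ LinearMap.fst K _ _ ∘ₗ Submodule.subtype _
  have hφ : Function.Injective φ := by
    rw [← LinearMap.ker_eq_bot, LinearMap.ker_eq_bot']
    rintro ⟨⟨A, B, C⟩, hx⟩ h
    have h0 (i : Fin a) : A i i = 0 := congrFun h i
    have hA : A = 0 := by
      ext i j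
      by_cases hij : i = j
      · rw [hij]; exact h0 j
      · have h1 := congrFun (congrFun (mem_blockStab.1 hx).1 i) j
        simp only [Matrix.diagonal_mul, Matrix.mul_zero, add_zero, Matrix.mul_diagonal] at h1
        have h2 : (d i - d j) * A i j = 0 := by linear_combination h1
        exact (mul_eq_zero.1 h2).resolve_left (sub_ne_zero.2 (hd.ne hij))
    exact Subtype.ext (Prod.ext hA (Subsingleton.elim _ _))
  simpa using LinearMap.finrank_le_finrank_of_injective hφ

theorem hasMinFinrankBlockStab_gcd (K : Type*) [Field K] [CharZero K] (a b : ℕ) :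
    HasMinFinrankBlockStab K a b (a.gcd b) := by
  induction h : a + b using Nat.strong_induction_on generalizing a b with
  | _ N ih =>
    subst h
    rcases Nat.eq_zero_or_pos a with rfl | ha
    · simpa using (hasMinFinrankBlockStab_zero K b).symm
    rcases Nat.eq_zero_or_pos b with rfl | hb
    · simpa using hasMinFinrankBlockStab_zero K a
    rcases le_total a b with hab | hab
    · obtain ⟨c, rfl⟩ := Nat.exists_eq_add_of_le hab
      simpa using (ih (a + c) (by omega) a c rfl).add_right
    · obtain ⟨c, rfl⟩ := Nat.exists_eq_add_of_le hab
      simpa [Nat.gcd_comm] using ((ih (b + c) (by omega) b c rfl).add_right).symm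

/-! ### The index of a maximal parabolic subalgebra -/

/-- The orthogonal of the block upper triangular matrices under the trace form. -/
theorem Matrix.forall_trace_mul_eq_zero_iff_of_toBlocks₂₁_eq_zero {K : Type*} [Field K]
    {m n : Type*} [Fintype m] [Fintype n] (X : Matrix (m ⊕ n) (m ⊕ n) K) :
    (∀ M : Matrix (m ⊕ n) (m ⊕ n) K, M.toBlocks₂₁ = 0 → (X * M).trace = 0) ↔
      X.toBlocks₁₁ = 0 ∧ X.toBlocks₂₁ = 0 ∧ X.toBlocks₂₂ = 0 := by
  classical
  constructor
  · intro h
    have key (i j : m ⊕ n) (hij : ∀ k l, ¬ (j = Sum.inr k ∧ i = Sum.inl l)) : X i j = 0 := by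
      have := h (Matrix.single j i 1) (by
        ext k l
        simp only [Matrix.toBlocks₂₁, Matrix.of_apply, Matrix.single_apply, Matrix.zero_apply]
        rw [if_neg (hij k l)])
      simpa [Matrix.trace_mul_comm X, Matrix.trace_single_mul] using this
    refine ⟨?_, ?_, ?_⟩ <;> ext i j <;> exact key _ _ (by simp)
  · rintro ⟨h1, h2, h3⟩ M hM
    rw [← Matrix.fromBlocks_toBlocks X, ← Matrix.fromBlocks_toBlocks M, h1, h2, h3, hM,
      Matrix.fromBlocks_multiply]
    simp [Matrix.trace]

theorem Matrix.toBlocks₂₁_add_smul_one {K : Type*} [Field K] {m n : Type*} [DecidableEq m]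
    [DecidableEq n] (M : Matrix (m ⊕ n) (m ⊕ n) K) (c : K) :
    (M + c • 1).toBlocks₂₁ = M.toBlocks₂₁ := by
  ext i j
  simp [Matrix.toBlocks₂₁]

theorem mem_blockStab_iff_forall_trace {K : Type*} [Field K] {m n : Type*} [Fintype m]
    [Fintype n] (F x : Matrix (m ⊕ n) (m ⊕ n) K) (hx : x.toBlocks₂₁ = 0) :
    (x.toBlocks₁₁, x.toBlocks₁₂, x.toBlocks₂₂) ∈
      blockStab F.toBlocks₁₁ F.toBlocks₂₁ F.toBlocks₂₂ ↔
    ∀ M : Matrix (m ⊕ n) (m ⊕ n) K, M.toBlocks₂₁ = 0 → ((F * x - x * F) * M).trace = 0 := by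
  have e : F * x = x * F + (F * x - x * F) := by abel
  rw [Matrix.forall_trace_mul_eq_zero_iff_of_toBlocks₂₁_eq_zero]
  generalize F * x - x * F = X at *
  rw [← Matrix.fromBlocks_toBlocks F, ← Matrix.fromBlocks_toBlocks x,
    ← Matrix.fromBlocks_toBlocks X, hx, Matrix.fromBlocks_multiply, Matrix.fromBlocks_multiply,
    Matrix.fromBlocks_add, Matrix.fromBlocks_inj] at e
  obtain ⟨e1, -, e2, e3⟩ := e
  simp only [Matrix.mul_zero, Matrix.zero_mul, add_zero, zero_add] at e1 e2 e3
  rw [mem_blockStab]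
  dsimp only
  rw [e1, e2]
  refine and_congr (by simp) (and_congr (by simp) ?_)
  rw [add_comm (_ * _) (_ * _), e3, eq_comm]
  simp

section index

variable {K : Type*} [Field K] {n a b : ℕ}

/-- The matrices `G' x G` of the elements `x` of `p`, where `G'` is meant to be the inverse of `G`:
the elements of `p` written in the basis of the columns of `G`. -/
def conjCoord (G : Matrix (Fin n) (Fin a ⊕ Fin b) K) (G' : Matrix (Fin a ⊕ Fin b) (Fin n) K)
    (p : LieSubalgebra K (slAlg K n)) : p →ₗ[K] Matrix (Fin a ⊕ Fin b) (Fin a ⊕ Fin b) K where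
  toFun x := G' * x.1.1 * G
  map_add' x y := by simp [Matrix.mul_add, Matrix.add_mul]
  map_smul' c x := by simp

variable {G : Matrix (Fin n) (Fin a ⊕ Fin b) K} {G' : Matrix (Fin a ⊕ Fin b) (Fin n) K}
  {p : LieSubalgebra K (slAlg K n)}

theorem conjCoord_injective (hG : G * G' = 1) : Function.Injective (conjCoord G G' p) := by
  intro x y h
  have h : G * (G' * x.1.1 * G) * G' = G * (G' * y.1.1 * G) * G' :=
    congrArg (fun X => G * X * G') h
  simp only [Matrix.mul_assoc, Matrix.mul_mul_cancel_left_of_mul_eq_one hG, hG,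
    Matrix.mul_one] at h
  exact Subtype.ext (Subtype.ext h)

theorem trace_conjCoord (hG : G * G' = 1) (x : p) : (conjCoord G G' p x).trace = 0 := by
  change (G' * x.1.1 * G).trace = 0
  rw [Matrix.mul_assoc, Matrix.trace_mul_comm, Matrix.mul_assoc, hG, Matrix.mul_one]
  exact x.1.2

theorem conjCoord_lie (hG : G * G' = 1) (x y : p) : conjCoord G G' p ⁅x, y⁆ =
    conjCoord G G' p x * conjCoord G G' p y - conjCoord G G' p y * conjCoord G G' p x := by
  change G' * (x.1.1 * y.1.1 - y.1.1 * x.1.1) * G =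
    G' * x.1.1 * G * (G' * y.1.1 * G) - G' * y.1.1 * G * (G' * x.1.1 * G)
  simp only [Matrix.mul_assoc, Matrix.mul_sub, Matrix.sub_mul,
    Matrix.mul_mul_cancel_left_of_mul_eq_one hG]

/-- Characteristic zero splits off the scalar matrices: a block upper triangular matrix is the sum
of a traceless one and a multiple of the identity. -/
theorem exists_conjCoord_eq [CharZero K] (hab : 0 < a + b) (hG' : G' * G = 1)
    (hp : ∀ x : slAlg K n, x ∈ p ↔ (G' * x.1 * G).toBlocks₂₁ = 0)
    (M : Matrix (Fin a ⊕ Fin b) (Fin a ⊕ Fin b) K) (hM : M.toBlocks₂₁ = 0) :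
    ∃ (y : p) (c : K), conjCoord G G' p y + c • 1 = M := by
  have h0 : ((a : K) + b) ≠ 0 := by exact_mod_cast hab.ne'
  let c : K := M.trace / (a + b)
  have h1 : G' * (G * (M - c • 1) * G') * G = M - c • 1 := by
    simp only [Matrix.mul_assoc, Matrix.mul_mul_cancel_left_of_mul_eq_one hG', hG', Matrix.mul_one]
  have htr : (G * (M - c • 1) * G').trace = 0 := by
    rw [Matrix.mul_assoc, Matrix.trace_mul_comm, Matrix.mul_assoc, hG', Matrix.mul_one,
      Matrix.trace_sub, Matrix.trace_smul, Matrix.trace_one]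
    simp [c, h0]
  refine ⟨⟨⟨G * (M - c • 1) * G', htr⟩, ?_⟩, c, ?_⟩
  · rw [hp, h1, sub_eq_add_neg, ← neg_smul, Matrix.toBlocks₂₁_add_smul_one, hM]
  · change G' * (G * (M - c • 1) * G') * G + c • 1 = M
    rw [h1, sub_add_cancel]

/-- Adding a scalar `c` to `x` does not change commutators, and neither does adding one to the
second argument of the form; so the trace condition can be dropped on both sides. -/
theorem mem_ker_kirillovForm_iff [CharZero K] (hab : 0 < a + b) (hG : G * G' = 1)
    (hG' : G' * G = 1) (hp : ∀ x : slAlg K n, x ∈ p ↔ (G' * x.1 * G).toBlocks₂₁ = 0)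
    (F : Matrix (Fin a ⊕ Fin b) (Fin a ⊕ Fin b) K) (f : Dual K p)
    (hf : ∀ x, f x = (F * conjCoord G G' p x).trace) (x : p) (c : K) :
    x ∈ LinearMap.ker (kirillovForm f) ↔
      ((conjCoord G G' p x + c • 1).toBlocks₁₁, (conjCoord G G' p x + c • 1).toBlocks₁₂,
        (conjCoord G G' p x + c • 1).toBlocks₂₂) ∈
      blockStab F.toBlocks₁₁ F.toBlocks₂₁ F.toBlocks₂₂ := by
  have hx (x : p) : (conjCoord G G' p x).toBlocks₂₁ = 0 := (hp x.1).1 x.2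
  have hxc : (conjCoord G G' p x + c • 1).toBlocks₂₁ = 0 := by
    rw [Matrix.toBlocks₂₁_add_smul_one, hx]
  rw [mem_blockStab_iff_forall_trace _ _ hxc]
  have key (y : p) : kirillovForm f x y = ((F * (conjCoord G G' p x + c • 1) -
      (conjCoord G G' p x + c • 1) * F) * conjCoord G G' p y).trace := by
    change f ⁅x, y⁆ = _
    rw [hf, conjCoord_lie hG, Matrix.mul_sub, Matrix.trace_sub, Matrix.mul_add, Matrix.add_mul,
      Matrix.mul_smul, Matrix.smul_mul, Matrix.mul_one, Matrix.one_mul, add_sub_add_right_eq_sub,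
      Matrix.sub_mul, Matrix.trace_sub, Matrix.mul_assoc, ← Matrix.mul_assoc F (conjCoord G G' p y),
      Matrix.trace_mul_comm (F * conjCoord G G' p y), Matrix.mul_assoc]
  rw [LinearMap.mem_ker]
  constructor
  · intro h M hM
    obtain ⟨y, d, rfl⟩ := exists_conjCoord_eq hab hG' hp M hM
    rw [Matrix.mul_add, Matrix.trace_add, ← key, h, Matrix.mul_smul, Matrix.mul_one,
      Matrix.trace_smul, Matrix.trace_sub, Matrix.trace_mul_comm]
    simp
  · intro h
    ext y
    rw [key, h _ (hx y)]
    rfl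

/-- The kernel for block upper triangular matrices of arbitrary trace is the kernel for those of
trace zero plus the line of scalar matrices. -/
theorem finrank_ker_kirillovForm_add_one [CharZero K] (hab : 0 < a + b) (hG : G * G' = 1)
    (hG' : G' * G = 1) (hp : ∀ x : slAlg K n, x ∈ p ↔ (G' * x.1 * G).toBlocks₂₁ = 0)
    (F : Matrix (Fin a ⊕ Fin b) (Fin a ⊕ Fin b) K) (f : Dual K p)
    (hf : ∀ x, f x = (F * conjCoord G G' p x).trace) :
    finrank K (LinearMap.ker (kirillovForm f)) + 1 =
      finrank K (blockStab F.toBlocks₁₁ F.toBlocks₂₁ F.toBlocks₂₂) := by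
  have h0 : ((a : K) + b) ≠ 0 := by exact_mod_cast hab.ne'
  have hx (x : p) : (conjCoord G G' p x).toBlocks₂₁ = 0 := (hp x.1).1 x.2
  have hxc (x : p) (c : K) : (conjCoord G G' p x + c • 1).toBlocks₂₁ = 0 := by
    rw [Matrix.toBlocks₂₁_add_smul_one, hx]
  rw [← finrank_self K, ← finrank_prod, ← finrank_top K (_ × K)]
  symm
  refine Submodule.finrank_eq_of_injective_of_mem_iff
    (fun z : LinearMap.ker (kirillovForm f) × K =>
      ((conjCoord G G' p z.1.1 + z.2 • 1).toBlocks₁₁,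
        (conjCoord G G' p z.1.1 + z.2 • 1).toBlocks₁₂,
        (conjCoord G G' p z.1.1 + z.2 • 1).toBlocks₂₂)) ?_ ?_ ?_ _ _ ?_ ?_
  · intro x y
    refine Prod.ext ?_ (Prod.ext ?_ ?_) <;> ext i j <;>
      simp [Matrix.toBlocks₁₁, Matrix.toBlocks₁₂, Matrix.toBlocks₂₂, add_mul] <;> ring
  · intro c x
    refine Prod.ext ?_ (Prod.ext ?_ ?_) <;> ext i j <;>
      simp [Matrix.toBlocks₁₁, Matrix.toBlocks₁₂, Matrix.toBlocks₂₂] <;> ring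
  · rintro ⟨⟨x, hxk⟩, c⟩ ⟨⟨y, hyk⟩, d⟩ h
    simp only [Prod.mk.injEq] at h
    obtain ⟨h1, h2, h3⟩ := h
    have h : conjCoord G G' p x + c • 1 = conjCoord G G' p y + d • 1 := by
      rw [← Matrix.fromBlocks_toBlocks (conjCoord G G' p x + c • 1),
        ← Matrix.fromBlocks_toBlocks (conjCoord G G' p y + d • 1), h1, h2, h3, hxc, hxc]
    have ht := congrArg Matrix.trace h
    simp only [Matrix.trace_add, trace_conjCoord hG, Matrix.trace_smul, Matrix.trace_one, zero_add,
      Fintype.card_sum, Fintype.card_fin, Nat.cast_add, smul_eq_mul] at ht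
    obtain rfl := mul_right_cancel₀ h0 ht
    obtain rfl := conjCoord_injective hG (add_right_cancel h)
    rfl
  · rintro ⟨x, c⟩ -
    exact (mem_ker_kirillovForm_iff hab hG hG' hp F f hf x.1 c).1 x.2
  · rintro ⟨A, B, C⟩ h
    obtain ⟨x, c, hxM⟩ := exists_conjCoord_eq hab hG' hp (Matrix.fromBlocks A B 0 C)
      (Matrix.toBlocks_fromBlocks₂₁ _ _ _ _)
    have e : ((conjCoord G G' p x + c • 1).toBlocks₁₁, (conjCoord G G' p x + c • 1).toBlocks₁₂,
        (conjCoord G G' p x + c • 1).toBlocks₂₂) = (A, B, C) := by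
      rw [hxM]
      simp
    exact ⟨(⟨x, (mem_ker_kirillovForm_iff hab hG hG' hp F f hf x c).2 (e ▸ h)⟩, c), trivial, e⟩

theorem exists_eq_trace_mul_conjCoord (hG : G * G' = 1) (f : Dual K p) :
    ∃ F : Matrix (Fin a ⊕ Fin b) (Fin a ⊕ Fin b) K, ∀ x, f x = (F * conjCoord G G' p x).trace := by
  obtain ⟨r, hr⟩ := LinearMap.exists_leftInverse_of_injective (conjCoord G G' p)
    (LinearMap.ker_eq_bot.2 (conjCoord_injective hG))
  refine ⟨Matrix.of fun i j => f (r (Matrix.single j i 1)), fun x => ?_⟩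
  have hx : f x = f (r (conjCoord G G' p x)) := by
    rw [show r (conjCoord G G' p x) = x from LinearMap.congr_fun hr x]
  rw [hx]
  generalize conjCoord G G' p x = M
  conv_lhs => rw [Matrix.matrix_eq_sum_single M]
  simp only [map_sum, Matrix.trace, Matrix.diag_apply, Matrix.mul_apply, Matrix.of_apply]
  rw [Finset.sum_comm]
  refine Finset.sum_congr rfl fun j _ => Finset.sum_congr rfl fun i _ => ?_
  have : Matrix.single i j (M i j) = M i j • Matrix.single i j (1 : K) := by simp
  rw [this, map_smul, map_smul, smul_eq_mul, mul_comm]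

theorem lieIndex_add_one_eq_gcd [CharZero K] (hab : 0 < a + b) (hG : G * G' = 1)
    (hG' : G' * G = 1) (hp : ∀ x : slAlg K n, x ∈ p ↔ (G' * x.1 * G).toBlocks₂₁ = 0) :
    lieIndex K p + 1 = a.gcd b := by
  obtain ⟨hmin, P, Q, R, hPQR⟩ := hasMinFinrankBlockStab_gcd K a b
  apply le_antisymm
  · let F := Matrix.fromBlocks P 0 Q R
    let f : Dual K p :=
      Matrix.traceLinearMap _ K K ∘ₗ LinearMap.mulLeft K F ∘ₗ conjCoord G G' p
    have h := finrank_ker_kirillovForm_add_one hab hG hG' hp F f (fun _ => rfl)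
    simp only [F, Matrix.toBlocks_fromBlocks₁₁, Matrix.toBlocks_fromBlocks₂₁,
      Matrix.toBlocks_fromBlocks₂₂] at h
    rw [← hPQR]
    exact (Nat.add_le_add_right (ciInf_le (OrderBot.bddBelow _) f) 1).trans_eq h
  · obtain ⟨f, hf⟩ := ciInf_mem
      (fun f : Dual K p => finrank K (LinearMap.ker (kirillovForm f)))
    obtain ⟨F, hF⟩ := exists_eq_trace_mul_conjCoord (G' := G') hG f
    rw [lieIndex, ← hf, finrank_ker_kirillovForm_add_one hab hG hG' hp F f hF]
    exact hmin _ _ _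

end index

/-! ### Stabilizers of subspaces -/

/-- A basis (the columns of `G`) whose first block spans `U`, so that `U` is cut out by the second
block of coordinates. -/
theorem Submodule.exists_adapted_matrix {K : Type*} [Field K] {n d c : ℕ}
    (U : Submodule K (Fin n → K)) (hU : finrank K U = d) (hn : n = d + c) :
    ∃ (G : Matrix (Fin n) (Fin d ⊕ Fin c) K) (G' : Matrix (Fin d ⊕ Fin c) (Fin n) K),
      G * G' = 1 ∧ G' * G = 1 ∧ ∀ v, v ∈ U ↔ ∀ j, G'.mulVec v (Sum.inr j) = 0 := by
  let B := finBasisOfFinrankEq K U hU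
  let Q : Matrix (Fin n) (Fin d) K := Matrix.of fun l i => (B i : Fin n → K) l
  have hQ (w : Fin d → K) : Q.mulVec w = B.equivFun.symm w := by
    ext l
    simp [Q, Matrix.mulVec, dotProduct, Basis.equivFun_symm_apply, mul_comm]
  have hinj : Function.Injective Q.mulVec := by
    intro w w' h
    rw [hQ, hQ] at h
    exact B.equivFun.symm.injective (Subtype.ext h)
  obtain ⟨G, G', hG, hG', hGQ⟩ :=
    Matrix.exists_mul_fromRows_one_zero_eq (c := c) (by simpa using hn) Q hinj
  refine ⟨G, G', hG, hG', fun v => ⟨fun hv j => ?_, fun hv => ?_⟩⟩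
  · have : v = Q.mulVec (B.equivFun ⟨v, hv⟩) := by rw [hQ]; simp
    rw [this, ← hGQ, Matrix.mulVec_mulVec, ← Matrix.mul_assoc, hG', Matrix.one_mul]
    simp [Matrix.fromRows_mulVec]
  · have h1 : G'.mulVec v = Matrix.mulVec
        (Matrix.fromRows (1 : Matrix (Fin d) (Fin d) K) (0 : Matrix (Fin c) (Fin d) K))
        (fun i => G'.mulVec v (Sum.inl i)) := by
      rw [Matrix.fromRows_mulVec]
      ext (i | j)
      · simp
      · simp [hv]
    have h2 : v = Q.mulVec (fun i => G'.mulVec v (Sum.inl i)) := by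
      rw [← hGQ, ← Matrix.mulVec_mulVec, ← h1, Matrix.mulVec_mulVec, hG, Matrix.one_mulVec]
    rw [h2, hQ]
    exact Subtype.property _

theorem Matrix.forall_mulVec_mem_iff_toBlocks₂₁_eq_zero {K : Type*} [Field K] {n d c : ℕ}
    {U : Submodule K (Fin n → K)} {G : Matrix (Fin n) (Fin d ⊕ Fin c) K}
    {G' : Matrix (Fin d ⊕ Fin c) (Fin n) K} (hG : G * G' = 1) (hG' : G' * G = 1)
    (hU : ∀ v, v ∈ U ↔ ∀ j, G'.mulVec v (Sum.inr j) = 0) (x : Matrix (Fin n) (Fin n) K) :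
    (∀ v ∈ U, x.mulVec v ∈ U) ↔ (G' * x * G).toBlocks₂₁ = 0 := by
  constructor
  · intro h
    ext i j
    have h1 : G.mulVec (Pi.single (Sum.inl j) 1) ∈ U := by
      rw [hU]
      intro k
      rw [Matrix.mulVec_mulVec, hG', Matrix.one_mulVec]
      simp
    have h2 := (hU _).1 (h _ h1) i
    rw [Matrix.mulVec_mulVec, Matrix.mulVec_mulVec,
      Matrix.mulVec_single_one] at h2
    exact h2
  · intro h v hv
    rw [hU] at hv ⊢
    intro i
    have h1 : G'.mulVec (x.mulVec v) = (G' * x * G).mulVec (G'.mulVec v) := by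
      simp only [Matrix.mulVec_mulVec, Matrix.mul_assoc, hG, Matrix.mul_one]
    rw [h1, Matrix.mulVec, dotProduct, Fintype.sum_sum_type]
    have h2 (j) : (G' * x * G) (Sum.inr i) (Sum.inl j) = 0 := congrFun (congrFun h i) j
    simp [hv, h2]

/-- `p` is the stabilizer of the subspace `U` in `sl(n)`. -/
def IsStabilizer {K : Type*} [Field K] {n : ℕ} (p : LieSubalgebra K (slAlg K n))
    (U : Submodule K (Fin n → K)) : Prop :=
  ∀ x : slAlg K n, x ∈ p ↔ ∀ v ∈ U, x.1.mulVec v ∈ U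

section stabilizer

variable {K : Type*} [Field K] {n : ℕ} {p q : LieSubalgebra K (slAlg K n)}
  {U V : Submodule K (Fin n → K)}

theorem IsStabilizer.lieIndex_add_one [CharZero K] (h : IsStabilizer p U) (hn : 0 < n) :
    lieIndex K p + 1 = (finrank K U).gcd n := by
  obtain ⟨c, hc⟩ := Nat.exists_eq_add_of_le
    (show finrank K U ≤ n by simpa using Submodule.finrank_le U)
  obtain ⟨G, G', hG, hG', hU⟩ := U.exists_adapted_matrix rfl hc
  rw [lieIndex_add_one_eq_gcd (hc ▸ hn) hG hG' fun x => (h x).trans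
    (Matrix.forall_mulVec_mem_iff_toBlocks₂₁_eq_zero hG hG' hU x.1)]
  calc (finrank K U).gcd c = (finrank K U).gcd (finrank K U + c) := by simp
    _ = _ := congrArg _ hc.symm

theorem Submodule.exists_dotProduct_eq_one_of_notMem {u : Fin n → K} (hu : u ∉ U) :
    ∃ φ : Fin n → K, φ ⬝ᵥ u = 1 ∧ ∀ w ∈ U, φ ⬝ᵥ w = 0 := by
  obtain ⟨f, hf, hfU⟩ := Submodule.exists_le_ker_of_notMem hu
  have hdot (w : Fin n → K) :
      (fun i => (f u)⁻¹ * f (Pi.single i 1) : Fin n → K) ⬝ᵥ w = (f u)⁻¹ * f w := by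
    conv_rhs => rw [LinearMap.pi_apply_eq_sum_univ f w]
    rw [dotProduct, Finset.mul_sum]
    refine Finset.sum_congr rfl fun i _ => ?_
    have : (fun j : Fin n => if i = j then (1 : K) else 0) = Pi.single i 1 := by
      ext j; simp [Pi.single_apply, eq_comm]
    rw [this, smul_eq_mul]
    ring
  refine ⟨(fun i => (f u)⁻¹ * f (Pi.single i 1) : Fin n → K), ?_, fun w hw => ?_⟩
  · rw [hdot, inv_mul_cancel₀ hf]
  · rw [hdot, LinearMap.mem_ker.1 (hfU hw), mul_zero]

/-- The rank one map `w ↦ φ(w) t` made traceless by a multiple of `w ↦ ψ(w) s`. -/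
theorem exists_slAlg_mulVec_eq (t φ s ψ : Fin n → K) (h : ψ ⬝ᵥ s = 1) :
    ∃ x : slAlg K n, ∀ w, x.1.mulVec w = (φ ⬝ᵥ w) • t - ((φ ⬝ᵥ t) * (ψ ⬝ᵥ w)) • s := by
  refine ⟨⟨Matrix.vecMulVec t φ - (φ ⬝ᵥ t) • Matrix.vecMulVec s ψ, ?_⟩, fun w => ?_⟩
  · change (Matrix.vecMulVec t φ - (φ ⬝ᵥ t) • Matrix.vecMulVec s ψ).trace = 0
    rw [Matrix.trace_sub, Matrix.trace_smul, Matrix.trace_vecMulVec, Matrix.trace_vecMulVec,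
      dotProduct_comm s, h, dotProduct_comm t]
    simp
  · rw [Matrix.sub_mulVec, Matrix.smul_mulVec, Matrix.vecMulVec_mulVec, Matrix.vecMulVec_mulVec]
    ext i
    simp
    ring

/-- `U` is the only proper nonzero subspace that its stabilizer preserves. -/
theorem IsStabilizer.eq_of_forall_mulVec_mem (h : IsStabilizer p U) (hU : U ≠ ⊥) (hU' : U ≠ ⊤)
    (hV : V ≠ ⊥) (hV' : V ≠ ⊤) (hpV : ∀ x ∈ p, ∀ v ∈ V, x.1.mulVec v ∈ V) : V = U := by
  have hle : V ≤ U := by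
    by_contra hle
    obtain ⟨v, hvV, hvU⟩ := SetLike.not_le_iff_exists.1 hle
    obtain ⟨φ, hφv, hφU⟩ := Submodule.exists_dotProduct_eq_one_of_notMem hvU
    obtain ⟨u, huU, hu0⟩ := U.ne_bot_iff.1 hU
    obtain ⟨ψ, hψu, -⟩ := Submodule.exists_dotProduct_eq_one_of_notMem
      (U := (⊥ : Submodule K (Fin n → K))) (u := u) (by simpa using hu0)
    have key (t : Fin n → K) : t - ((φ ⬝ᵥ t) * (ψ ⬝ᵥ v)) • u ∈ V := by
      obtain ⟨x, hx⟩ := exists_slAlg_mulVec_eq t φ u ψ hψu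
      have hxp : x ∈ p := by
        rw [h]
        intro w hw
        rw [hx, hφU w hw, zero_smul, zero_sub]
        exact U.neg_mem (U.smul_mem _ huU)
      simpa [hx, hφv] using hpV x hxp v hvV
    -- `t = u` has `φ t = 0`, so `u` lies in `V`, and then so does every `t`.
    have huV : u ∈ V := by simpa [hφU u huU] using key u
    exact hV' (eq_top_iff.2 fun t _ => by
      simpa using V.add_mem (key t) (V.smul_mem ((φ ⬝ᵥ t) * (ψ ⬝ᵥ v)) huV))
  refine le_antisymm hle fun t ht => ?_
  obtain ⟨v, hvV, hv0⟩ := V.ne_bot_iff.1 hV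
  obtain ⟨φ, hφv, -⟩ := Submodule.exists_dotProduct_eq_one_of_notMem
    (U := (⊥ : Submodule K (Fin n → K))) (u := v) (by simpa using hv0)
  obtain ⟨s, -, hsU⟩ := SetLike.exists_of_lt (lt_top_iff_ne_top.2 hU')
  obtain ⟨ψ, hψs, hψU⟩ := Submodule.exists_dotProduct_eq_one_of_notMem hsU
  obtain ⟨x, hx⟩ := exists_slAlg_mulVec_eq t φ s ψ hψs
  have hxp : x ∈ p := by
    rw [h]
    intro w hw
    rw [hx, hψU w hw, mul_zero, zero_smul, sub_zero]
    exact U.smul_mem _ ht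
  simpa [hx, hφv, hψU v (hle hvV)] using hpV x hxp v hvV

theorem Matrix.SpecialLinearGroup.coe_inv_mul_coe (g : Matrix.SpecialLinearGroup (Fin n) K) :
    (g⁻¹).1 * g.1 = 1 := by
  rw [← Matrix.SpecialLinearGroup.coe_mul, inv_mul_cancel, Matrix.SpecialLinearGroup.coe_one]

theorem Matrix.SpecialLinearGroup.coe_mul_coe_inv (g : Matrix.SpecialLinearGroup (Fin n) K) :
    g.1 * (g⁻¹).1 = 1 := by
  rw [← Matrix.SpecialLinearGroup.coe_mul, mul_inv_cancel, Matrix.SpecialLinearGroup.coe_one]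

/-- A conjugating element `g` carries `U` to a subspace preserved by `q`, which can only be `V`. -/
theorem IsStabilizer.finrank_eq_of_isConjSubalgebra (h : IsStabilizer p U) (h' : IsStabilizer q V)
    (hU : U ≠ ⊥) (hU' : U ≠ ⊤) (hV : V ≠ ⊥) (hV' : V ≠ ⊤) (hpq : IsConjSubalgebra p q) :
    finrank K U = finrank K V := by
  obtain ⟨g, hg⟩ := hpq
  have hginj : Function.Injective (Matrix.mulVecLin g.1) := by
    intro v w e
    have e : (g⁻¹).1.mulVec (g.1.mulVec v) = (g⁻¹).1.mulVec (g.1.mulVec w) :=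
      congrArg (g⁻¹).1.mulVec e
    rwa [Matrix.mulVec_mulVec, Matrix.mulVec_mulVec, g.coe_inv_mul_coe, Matrix.one_mulVec,
      Matrix.one_mulVec] at e
  have hfin : finrank K (U.map (Matrix.mulVecLin g.1)) = finrank K U :=
    ((Submodule.equivMapOfInjective _ hginj U).finrank_eq).symm
  have hne : U.map (Matrix.mulVecLin g.1) ≠ ⊥ := by
    intro hb
    rw [hb, finrank_bot, eq_comm, Submodule.finrank_eq_zero] at hfin
    exact hU hfin
  have hne' : U.map (Matrix.mulVecLin g.1) ≠ ⊤ := by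
    intro ht
    rw [ht, finrank_top] at hfin
    exact hU' (Submodule.eq_top_of_finrank_eq hfin.symm)
  rw [← hfin, h'.eq_of_forall_mulVec_mem hV hV' hne hne']
  rintro x hx _ ⟨u, hu, rfl⟩
  obtain ⟨y, hy, hyx⟩ := (Set.ext_iff.1 hg x.1).1 ⟨x, hx, rfl⟩
  refine ⟨y.1.mulVec u, (h y).1 hy u hu, ?_⟩
  rw [Matrix.mulVecLin_apply, Matrix.mulVecLin_apply, ← hyx, Matrix.mulVec_mulVec,
    Matrix.mulVec_mulVec, Matrix.mul_assoc _ _ g.1, g.coe_inv_mul_coe, Matrix.mul_one]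

theorem IsStabilizer.isConjSubalgebra (h : IsStabilizer p U) (h' : IsStabilizer q V)
    (g : Matrix.SpecialLinearGroup (Fin n) K) (hg : ∀ v, v ∈ U ↔ g.1.mulVec v ∈ V) :
    IsConjSubalgebra p q := by
  have hg1 := g.coe_inv_mul_coe
  have hg2 := g.coe_mul_coe_inv
  refine ⟨g, Set.ext fun x => ⟨?_, ?_⟩⟩
  · rintro ⟨x, hx, rfl⟩
    refine ⟨⟨(g⁻¹).1 * x.1 * g.1, ?_⟩, ?_, ?_⟩
    · change ((g⁻¹).1 * x.1 * g.1).trace = 0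
      rw [Matrix.mul_assoc, Matrix.trace_mul_comm, Matrix.mul_assoc, hg2, Matrix.mul_one]
      exact x.2
    · rw [h]
      intro v hv
      change ((g⁻¹).1 * x.1 * g.1).mulVec v ∈ U
      rw [hg, Matrix.mulVec_mulVec, Matrix.mul_assoc,
        Matrix.mul_mul_cancel_left_of_mul_eq_one hg2, ← Matrix.mulVec_mulVec]
      exact (h' x).1 hx _ ((hg v).1 hv)
    · simp only [Matrix.mul_assoc, Matrix.mul_mul_cancel_left_of_mul_eq_one hg2, hg2,
        Matrix.mul_one]
  · rintro ⟨y, hy, rfl⟩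
    refine ⟨⟨g.1 * y.1 * (g⁻¹).1, ?_⟩, ?_, rfl⟩
    · change (g.1 * y.1 * (g⁻¹).1).trace = 0
      rw [Matrix.mul_assoc, Matrix.trace_mul_comm, Matrix.mul_assoc, hg1, Matrix.mul_one]
      exact y.2
    · rw [h']
      intro v hv
      have hv' : (g⁻¹).1.mulVec v ∈ U := by
        rw [hg, Matrix.mulVec_mulVec, hg2, Matrix.one_mulVec]
        exact hv
      change (g.1 * y.1 * (g⁻¹).1).mulVec v ∈ V
      rw [Matrix.mul_assoc, ← Matrix.mulVec_mulVec, ← hg, ← Matrix.mulVec_mulVec]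
      exact (h y).1 hy _ hv'

/-- An invertible matrix carrying `U` to `V` is given determinant one by an `n`-th root, which
changes neither subspace. -/
theorem IsStabilizer.isConjSubalgebra_of_finrank_eq [IsAlgClosed K] (hn : 0 < n)
    (h : IsStabilizer p U) (h' : IsStabilizer q V) (hUV : finrank K U = finrank K V) :
    IsConjSubalgebra p q := by
  obtain ⟨c, hc⟩ := Nat.exists_eq_add_of_le
    (show finrank K U ≤ n by simpa using Submodule.finrank_le U)
  obtain ⟨G, G', hG, hG', hGU⟩ := U.exists_adapted_matrix rfl hc
  obtain ⟨H, H', hH, hH', hHV⟩ := V.exists_adapted_matrix hUV.symm hc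
  have hdet : (H * G').det ≠ 0 := by
    have : (H * G') * (G * H') = 1 := by
      rw [Matrix.mul_assoc, Matrix.mul_mul_cancel_left_of_mul_eq_one hG', hH]
    exact (Matrix.isUnit_det_of_right_inverse this).ne_zero
  obtain ⟨s, hs⟩ := IsAlgClosed.exists_pow_nat_eq ((H * G').det)⁻¹ hn
  have hs0 : s ≠ 0 := by
    rintro rfl
    rw [zero_pow hn.ne'] at hs
    exact inv_ne_zero hdet hs.symm
  refine h.isConjSubalgebra h' ⟨s • (H * G'), ?_⟩ fun v => ?_
  · rw [Matrix.det_smul, Fintype.card_fin, hs, inv_mul_cancel₀ hdet]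
  · dsimp only
    rw [hGU, hHV, Matrix.smul_mulVec, Matrix.mulVec_smul, Matrix.mulVec_mulVec,
      Matrix.mul_mul_cancel_left_of_mul_eq_one hH']
    simp [hs0]

end stabilizer

/-! ### Conjugacy classes of maximal parabolic subalgebras -/

section parabolic

variable {K : Type*} [Field K] {n : ℕ}

theorem Module.Basis.finrank_span_setOf (e : Basis (Fin n) K (Fin n → K)) (P : Fin n → Prop)
    [DecidablePred P] :
    finrank K (Submodule.span K {v | ∃ l, P l ∧ v = e l}) = Fintype.card {l // P l} := by
  have : {v | ∃ l, P l ∧ v = e l} = Set.range fun l : {l // P l} => e l := by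
    ext v
    simp [eq_comm]
  rw [this]
  exact finrank_span_eq_card (e.linearIndependent.comp _ Subtype.val_injective)

theorem finrank_flagV (e : Basis (Fin n) K (Fin n → K)) (a : Composition n) (i : ℕ) :
    finrank K (flagV e a i) = a.sizeUpTo i := by
  rw [flagV, e.finrank_span_setOf, Fintype.card_subtype]
  have := a.sizeUpTo_le i
  simp [Fin.card_filter_val_lt, this]

theorem finrank_flagW (e : Basis (Fin n) K (Fin n → K)) (b : Composition n) (j : ℕ) :
    finrank K (flagW e b j) = n - b.sizeUpTo j := by
  rw [flagW, e.finrank_span_setOf, Fintype.card_subtype]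
  have h : (Finset.univ.filter fun l : Fin n => b.sizeUpTo j ≤ l) =
      (Finset.univ.filter fun l : Fin n => (l : ℕ) < b.sizeUpTo j)ᶜ := by
    ext l
    simp
  have := b.sizeUpTo_le j
  rw [h, Finset.card_compl]
  simp [Fin.card_filter_val_lt, this]

theorem Submodule.mulVec_mem_of_finrank {U : Submodule K (Fin n → K)}
    (h : finrank K U = 0 ∨ finrank K U = n) (x : Matrix (Fin n) (Fin n) K) (v : Fin n → K)
    (hv : v ∈ U) : x.mulVec v ∈ U := by
  rcases h with h | h
  · rw [Submodule.finrank_eq_zero] at h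
    subst h
    rw [Submodule.mem_bot] at hv
    simp [hv]
  · have : U = ⊤ := Submodule.eq_top_of_finrank_eq (by simpa using h)
    simp [this]

theorem Composition.sizeUpTo_eq_of_length_eq_one {a : Composition n} (h : a.length = 1) (i : ℕ) :
    a.sizeUpTo i = 0 ∨ a.sizeUpTo i = n := by
  rcases Nat.eq_zero_or_pos i with rfl | hi
  · exact Or.inl a.sizeUpTo_zero
  · exact Or.inr (a.sizeUpTo_ofLength_le i (by omega))

theorem Composition.sizeUpTo_eq_of_length_eq_two {a : Composition n} (h : a.length = 2) {i : ℕ}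
    (hi : i ≠ 1) : a.sizeUpTo i = 0 ∨ a.sizeUpTo i = n := by
  rcases Nat.eq_zero_or_pos i with rfl | hi
  · exact Or.inl a.sizeUpTo_zero
  · exact Or.inr (a.sizeUpTo_ofLength_le i (by omega))

theorem isStabilizer_seaweed_flagV (e : Basis (Fin n) K (Fin n → K)) {a b : Composition n}
    (ha : a.length = 2) (hb : b.length = 1) : IsStabilizer (seaweed e a b) (flagV e a 1) := by
  refine fun x => ⟨fun hx => hx.1 1, fun hx => ⟨fun i => ?_, fun j => ?_⟩⟩
  · by_cases hi : i = 1
    · rw [hi]; exact hx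
    · exact Submodule.mulVec_mem_of_finrank
        (by rw [finrank_flagV]; exact a.sizeUpTo_eq_of_length_eq_two ha hi) _
  · refine Submodule.mulVec_mem_of_finrank ?_ _
    rw [finrank_flagW]
    have := b.sizeUpTo_eq_of_length_eq_one hb j
    omega

theorem isStabilizer_seaweed_flagW (e : Basis (Fin n) K (Fin n → K)) {a b : Composition n}
    (ha : a.length = 1) (hb : b.length = 2) : IsStabilizer (seaweed e a b) (flagW e b 1) := by
  refine fun x => ⟨fun hx => hx.2 1, fun hx => ⟨fun i => ?_, fun j => ?_⟩⟩
  · exact Submodule.mulVec_mem_of_finrank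
      (by rw [finrank_flagV]; exact a.sizeUpTo_eq_of_length_eq_one ha i) _
  · by_cases hj : j = 1
    · rw [hj]; exact hx
    · refine Submodule.mulVec_mem_of_finrank ?_ _
      rw [finrank_flagW]
      have := b.sizeUpTo_eq_of_length_eq_two hb hj
      omega

theorem Composition.sizeUpTo_one_pos_and_lt {a : Composition n} (h : a.length = 2) :
    0 < a.sizeUpTo 1 ∧ a.sizeUpTo 1 < n := by
  have h0 := a.sizeUpTo_strict_mono (i := 0) (by omega)
  have h1 := a.sizeUpTo_strict_mono (i := 1) (by omega)
  have h2 := a.sizeUpTo_le 2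
  simp only [zero_add] at h0
  exact ⟨by omega, lt_of_lt_of_le h1 h2⟩

theorem IsMaximalParabolic.exists_isStabilizer {p : LieSubalgebra K (slAlg K n)}
    (h : IsMaximalParabolic p) :
    ∃ U : Submodule K (Fin n → K), 0 < finrank K U ∧ finrank K U < n ∧ IsStabilizer p U := by
  obtain ⟨e, a, b, ⟨ha, hb⟩ | ⟨ha, hb⟩, rfl⟩ := h
  · have := a.sizeUpTo_one_pos_and_lt ha
    exact ⟨flagV e a 1, by rw [finrank_flagV]; exact this.1, by rw [finrank_flagV]; exact this.2,
      isStabilizer_seaweed_flagV e ha hb⟩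
  · have := b.sizeUpTo_one_pos_and_lt hb
    exact ⟨flagW e b 1, by rw [finrank_flagW]; omega, by rw [finrank_flagW]; omega,
      isStabilizer_seaweed_flagW e ha hb⟩

theorem exists_isMaximalParabolic_isStabilizer {d : ℕ} (hd : 0 < d) (hdn : d < n) :
    ∃ p : LieSubalgebra K (slAlg K n), IsMaximalParabolic p ∧
      ∃ U : Submodule K (Fin n → K), finrank K U = d ∧ IsStabilizer p U := by
  let a : Composition n := ⟨[d, n - d], by simp; omega, by simp; omega⟩
  let b : Composition n := Composition.single n (by omega)
  have hb : b.length = 1 := Composition.single_length _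
  refine ⟨seaweed (Pi.basisFun K (Fin n)) a b, ⟨_, a, b, Or.inl ⟨rfl, hb⟩, rfl⟩,
    flagV (Pi.basisFun K (Fin n)) a 1, ?_, isStabilizer_seaweed_flagV _ rfl hb⟩
  rw [finrank_flagV]
  simp [Composition.sizeUpTo, a]

/-- The classes correspond to the dimensions `d` of the stabilized subspaces, and the index is
`gcd (n, d) - 1`. -/
theorem numMaxParabolicClasses_eq_encard [IsAlgClosed K] [CharZero K] (k : ℕ) :
    numMaxParabolicClasses K n k = {d : ℕ | 0 < d ∧ d < n ∧ n.gcd d = k + 1}.encard := by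
  have hne {U : Submodule K (Fin n → K)} (h0 : 0 < finrank K U) (h1 : finrank K U < n) :
      U ≠ ⊥ ∧ U ≠ ⊤ :=
    ⟨by rintro rfl; simp at h0, by rintro rfl; simp at h1⟩
  choose! p hp U hUd hpU using
    fun (d : ℕ) (h : 0 < d ∧ d < n) => exists_isMaximalParabolic_isStabilizer (K := K) h.1 h.2
  have hinj : Set.InjOn (fun d => Quotient.mk (conjSetoid K n) (p d))
      {d : ℕ | 0 < d ∧ d < n ∧ n.gcd d = k + 1} := by
    rintro d ⟨hd0, hdn, -⟩ d' ⟨hd0', hdn', -⟩ h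
    have hconj : IsConjSubalgebra (p d) (p d') := Quotient.exact h
    have hd := hUd d ⟨hd0, hdn⟩
    have hd' := hUd d' ⟨hd0', hdn'⟩
    obtain ⟨h1, h2⟩ := hne (hd0.trans_eq hd.symm) (hd.trans_lt hdn)
    obtain ⟨h1', h2'⟩ := hne (hd0'.trans_eq hd'.symm) (hd'.trans_lt hdn')
    rw [← hd, ← hd']
    exact (hpU d ⟨hd0, hdn⟩).finrank_eq_of_isConjSubalgebra (hpU d' ⟨hd0', hdn'⟩)
      h1 h2 h1' h2' hconj
  rw [← hinj.encard_image, numMaxParabolicClasses]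
  congr 1
  ext c
  constructor
  · rintro ⟨q, hq, hqk, rfl⟩
    obtain ⟨V, hV0, hVn, hqV⟩ := hq.exists_isStabilizer
    refine ⟨finrank K V, ⟨hV0, hVn, ?_⟩, Quotient.sound ?_⟩
    · rw [Nat.gcd_comm, ← hqV.lieIndex_add_one (by omega), hqk]
    · exact (hpU _ ⟨hV0, hVn⟩).isConjSubalgebra_of_finrank_eq (by omega) hqV (hUd _ ⟨hV0, hVn⟩)
  · rintro ⟨d, ⟨hd0, hdn, hdk⟩, rfl⟩
    refine ⟨p d, hp d ⟨hd0, hdn⟩, ?_, rfl⟩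
    have := (hpU d ⟨hd0, hdn⟩).lieIndex_add_one (by omega)
    rw [hUd d ⟨hd0, hdn⟩, Nat.gcd_comm, hdk] at this
    omega

end parabolic

theorem mainTheorem6 (K : Type*) [Field K] [IsAlgClosed K] [CharZero K]
    (n k : ℕ) (hn : 1 ≤ n) :
    (∀ t : ℕ, 2 ≤ t → n = (k + 1) * t →
      numMaxParabolicClasses K n k = (Nat.totient t : ℕ∞)) ∧
    ((¬ ∃ t : ℕ, 2 ≤ t ∧ n = (k + 1) * t) → numMaxParabolicClasses K n k = 0) := by
  rw [numMaxParabolicClasses_eq_encard]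
  constructor
  · rintro t ht rfl
    have h := Nat.totient_div_of_dvd (Dvd.intro t rfl : k + 1 ∣ (k + 1) * t)
    rw [Nat.mul_div_cancel_left t k.succ_pos] at h
    rw [h, ← Set.encard_coe_eq_coe_finsetCard]
    congr 1
    ext d
    simp only [Set.mem_ofPred_eq, Finset.coe_filter, Finset.mem_range]
    refine ⟨fun h => h.2, fun h => ⟨Nat.pos_of_ne_zero ?_, h⟩⟩
    -- `d = 0` would give `gcd (n, d) = n = (k + 1) t`, which exceeds `k + 1`.
    rintro rfl
    have := h.2
    rw [Nat.gcd_zero_right] at this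
    nlinarith
  · intro h
    rw [Set.encard_eq_zero, Set.eq_empty_iff_forall_notMem]
    rintro d ⟨hd0, hdn, hd⟩
    obtain ⟨t, ht⟩ : k + 1 ∣ n := hd ▸ Nat.gcd_dvd_left n d
    refine h ⟨t, ?_, ht⟩
    have hle : k + 1 ≤ d := hd ▸ Nat.gcd_le_right n hd0
    by_contra hlt
    have : t ≤ 1 := by omega
    nlinarith
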